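/- Let $R$ be a commutative ring that is not noetherian, let $\mathcal C=\mathrm{Mod}(R)$ be the category of (small) $R$-modules and, for a regular cardinal $\alpha$, let $\mathcal C^\alpha\subseteq\mathcal C$ be the full subcategory of $\alpha$-presentable modules. Let $\mathrm{Mod}(\mathcal C^\alpha)$ be the abelian category of additive functors $(\mathcal C^\alpha)^{\mathrm{op}}\to\mathrm{Ab}$. The restricted Yoneda functor $\mathcal C\to\mathrm{Mod}(\mathcal C^\alpha)$, $X\mapsto\mathcal C(-,X)|_{\mathcal C^\alpha}$, has an exact left adjoint; let $Q\colon D(\mathrm{Mod}(\mathcal C^\alpha))\to D(\mathcal C)$ be the functor it induces on unbounded derived categories, and let $\mathcal S\subseteq D(\mathrm{Mod}(\mathcal C^\alpha))$ be the class of representable functors $\mathcal C^\alpha(-,A)$, $A\in\mathcal C^\alpha$, placed in degree $0$. Then for every sufficiently large regular cardinal $\alpha$ (that is, there is a cardinal $\alpha_0$ such that for every regular $\alpha\ge\alpha_0$): 1. $Q$ is a Verdier quotient functor, i.e. it exhibits $D(\mathcal C)$ as the Verdier quotient of $D(\mathrm{Mod}(\mathcal C^\alpha))$ by $\ker Q$;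 2. the composition of the Yoneda embedding $\mathcal C^\alpha\to\mathrm{Mod}(\mathcal C^\alpha)\subset D(\mathrm{Mod}(\mathcal C^\alpha))$ with $Q$ is isomorphic to the inclusion $\mathcal C^\alpha\subseteq\mathcal C\subset D(\mathcal C)$, so that $Q(\mathcal S)$ is identified with $\mathcal C^\alpha$; 3. $Q(\mathcal S)$ does not satisfy the following axiom (G2) in $\mathcal T=D(\mathcal C)$: for every small family of maps $\{X_i\to Y_i\}_{i\in I}$ in $\mathcal T$ such that $\mathcal T(S,X_i)\to\mathcal T(S,Y_i)$ is surjective for all $i\in I$ and all $S\in Q(\mathcal S)$, the induced map $\mathcal T(S,\coprod_i X_i)\to\mathcal T(S,\coprod_i Y_i)$ is surjective for all $S\in Q(\mathcal S)$. -/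

import Mathlib

open CategoryTheory CategoryTheory.Limits Opposite

universe w w' u v

noncomputable section

namespace WellGen

/-! ### Axiom (G2) -/

/-- Axiom (G2) for a class `S` of objects of a category `T`: for every small family of maps
`X i ⟶ Y i` such that `T(s, X i) ⟶ T(s, Y i)` is surjective for all `i` and all `s` in `S`,
the induced map `T(s, ∐ X i) ⟶ T(s, ∐ Y i)` is surjective for all `s` in `S`. The coproducts are
given by arbitrary colimit cofans. -/
def SatisfiesG2 {T : Type v} [Category.{w} T] (S : ObjectProperty T) : Prop :=
  ∀ (I : Type u) (X Y : I → T) (f : ∀ i, X i ⟶ Y i),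
    (∀ (i : I) (s : T), S s → Function.Surjective (fun g : s ⟶ X i ↦ g ≫ f i)) →
    ∀ (cX : Cofan X) (hX : IsColimit cX) (cY : Cofan Y) (_ : IsColimit cY) (s : T), S s →
      Function.Surjective
        (fun g : s ⟶ cX.pt ↦ g ≫ Cofan.IsColimit.desc hX (fun i ↦ f i ≫ cY.inj i))

/-! ### Modules over a preadditive category -/

/-- `Mod A`: the category of additive functors `Aᵒᵖ ⥤ Ab`. -/
abbrev Modules (A : Type v) [Category.{u} A] [Preadditive A] := Aᵒᵖ ⥤+ AddCommGrpCat.{u}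

section Abelian

variable {A : Type v} [Category.{u} A] [Preadditive A]

lemma additive_of_mono {F G : A ⥤ AddCommGrpCat.{u}} (i : F ⟶ G) [∀ X, Mono (i.app X)]
    [G.Additive] : F.Additive where
  map_add {X Y f g} := by
    rw [← cancel_mono (i.app Y)]
    simp [Preadditive.add_comp, Preadditive.comp_add]

lemma additive_of_epi {F G : A ⥤ AddCommGrpCat.{u}} (p : F ⟶ G) [∀ X, Epi (p.app X)]
    [F.Additive] : G.Additive where
  map_add {X Y f g} := by
    rw [← cancel_epi (p.app X)]
    simp [Preadditive.add_comp, Preadditive.comp_add, ← NatTrans.naturality]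

instance : (additiveFunctor A AddCommGrpCat.{u}).ContainsZero where
  exists_zero := by
    have h : IsZero (AddCommGrpCat.of PUnit.{u + 1}) := AddCommGrpCat.isZero_of_subsingleton _
    refine ⟨(Functor.const _).obj (AddCommGrpCat.of PUnit.{u + 1}), ?_, ⟨fun {X Y f g} ↦ ?_⟩⟩
    · rw [Functor.isZero_iff]
      exact fun _ ↦ h
    · exact h.eq_of_src _ _

instance : (additiveFunctor A AddCommGrpCat.{u}).IsClosedUnderKernels where
  kernels_le := by
    rintro _ ⟨f, k, hk, h₁, h₂⟩
    have : Functor.Additive _ := h₁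
    have : Mono (Fork.ι k) := Fork.IsLimit.mono hk
    exact additive_of_mono (Fork.ι k)

instance : (additiveFunctor A AddCommGrpCat.{u}).IsClosedUnderCokernels where
  cokernels_le := by
    rintro _ ⟨f, k, hk, h₁, h₂⟩
    have : Functor.Additive _ := h₂
    have : Epi (Cofork.π k) := Cofork.IsColimit.epi hk
    exact additive_of_epi (Cofork.π k)

instance : (additiveFunctor A AddCommGrpCat.{u}).IsClosedUnderFiniteProducts where
  isClosedUnderLimitsOfShape J _ :=
    { limitsOfShape_le := by
        rintro F ⟨h⟩
        refine ⟨fun {X Y f g} ↦ ?_⟩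
        refine (isLimitOfPreserves ((evaluation _ _).obj Y) h.isLimit).hom_ext fun j ↦ ?_
        have : (h.diag.obj j).Additive := h.prop_diag_obj j
        have e (t : X ⟶ Y) : F.map t ≫ (h.π.app j).app Y =
          (h.π.app j).app X ≫ (h.diag.obj j).map t := (h.π.app j).naturality t
        change F.map (f + g) ≫ (h.π.app j).app Y = (F.map f + F.map g) ≫ (h.π.app j).app Y
        rw [e, Preadditive.add_comp, e, e, Functor.map_add, Preadditive.comp_add] }

end Abelian

/-- The restricted Yoneda functor `C ⥤ Mod P` of a full subcategory `P` of a preadditive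
category `C`, sending `X` to `C(-, X)` restricted to `P`. -/
def restrictedYoneda {C : Type v} [Category.{u} C] [Preadditive C] (P : ObjectProperty C) :
    C ⥤ Modules P.FullSubcategory :=
  ObjectProperty.lift _
    (preadditiveYoneda ⋙ (Functor.whiskeringLeft _ _ _).obj P.ι.op)
    (fun X ↦ by
      change (P.ι.op ⋙ preadditiveYoneda.obj X).Additive
      infer_instance)

/-- The Yoneda embedding `A ⥤ Mod A`, sending `X` to `A(-, X)`. -/
def yonedaModule (A : Type v) [Category.{u} A] [Preadditive A] : A ⥤ Modules A :=
  ObjectProperty.lift _ preadditiveYoneda (fun X ↦ by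
    change (preadditiveYoneda.obj X).Additive
    infer_instance)

/-! ### The setting: presentable modules over a commutative ring -/

section

variable (R : Type u) [CommRing R] (κ : Cardinal.{u}) [Fact κ.IsRegular]

/-- The full subcategory `C^κ` of `κ`-presentable objects of `C = Mod R`. -/
abbrev Presentable := (isCardinalPresentable (ModuleCat.{u} R) κ).FullSubcategory

/-- The restricted Yoneda functor `Mod R ⥤ Mod C^κ`. -/
abbrev nerve : ModuleCat.{u} R ⥤ Modules (Presentable R κ) :=
  restrictedYoneda (isCardinalPresentable (ModuleCat.{u} R) κ)

instance isCardinalPresentable_self : IsCardinalPresentable (ModuleCat.of R R) κ := by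
  have : (forget (ModuleCat.{u} R)).IsCardinalAccessible κ :=
    { preservesColimitOfShape := fun J _ _ ↦ by
        have := isFiltered_of_isCardinalFiltered J κ
        infer_instance }
  let e : coyoneda.obj (op (ModuleCat.of R R)) ≅ forget (ModuleCat.{u} R) :=
    NatIso.ofComponents (fun M ↦ Equiv.toIso
      (ModuleCat.homEquiv.trans (LinearMap.ringLmapEquivSelf R R M).toEquiv))
      (fun {M N} f ↦ rfl)
  exact Functor.isCardinalAccessible_of_natIso e.symm κ

/-- The ring `R`, as a `κ`-presentable `R`-module. -/
abbrev selfObj : Presentable R κ := ⟨ModuleCat.of R R, isCardinalPresentable_self R κ⟩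

variable {R κ} in
/-- The linear map `R ⟶ X` sending `1` to `x`. -/
def elementMap (X : Presentable R κ) (x : X.obj) : selfObj R κ ⟶ X :=
  ObjectProperty.homMk (ModuleCat.ofHom (LinearMap.toSpanSingleton R X.obj x))

lemma elementMap_add (X : Presentable R κ) (x y : X.obj) :
    elementMap X (x + y) = elementMap X x + elementMap X y := by
  ext : 2
  refine LinearMap.ext fun r ↦ ?_
  exact smul_add r x y

lemma elementMap_comp {X Y : Presentable R κ} (x : X.obj) (f : X ⟶ Y) :
    elementMap X x ≫ f = elementMap Y (f.hom x) := by
  ext : 2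
  refine LinearMap.ext fun r ↦ ?_
  exact f.hom.hom.map_smul r x

lemma elementMap_one : elementMap (selfObj R κ) (1 : R) = 𝟙 _ := by
  ext : 2
  refine LinearMap.ext fun r ↦ ?_
  exact mul_one r

variable {R κ} in
/-- The value at `R` of a module over `C^κ` is an `R`-module. -/
abbrev evalModule (M : Modules (Presentable R κ)) : Module R (M.obj.obj (op (selfObj R κ))) where
  smul r m := M.obj.map (elementMap (selfObj R κ) r).op m
  one_smul m := by
    change M.obj.map (elementMap (selfObj R κ) 1).op m = m
    rw [elementMap_one]; simp
  mul_smul r s m := by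
    change M.obj.map (elementMap (selfObj R κ) (r * s)).op m =
      M.obj.map (elementMap (selfObj R κ) r).op (M.obj.map (elementMap (selfObj R κ) s).op m)
    have : elementMap (selfObj R κ) (r * s) =
      elementMap (selfObj R κ) r ≫ elementMap (selfObj R κ) s := by
      rw [elementMap_comp]; rfl
    rw [this]; simp
  smul_zero r := map_zero (M.obj.map (elementMap (selfObj R κ) r).op).hom
  smul_add r := map_add (M.obj.map (elementMap (selfObj R κ) r).op).hom
  add_smul r s m := by
    change M.obj.map (elementMap (selfObj R κ) (r + s)).op m =
      M.obj.map (elementMap (selfObj R κ) r).op m + M.obj.map (elementMap (selfObj R κ) s).op m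
    have : elementMap (selfObj R κ) (r + s) = _ := elementMap_add R κ (selfObj R κ) r s
    rw [this, op_add, Functor.map_add]; rfl
  zero_smul m := by
    change M.obj.map (elementMap (selfObj R κ) 0).op m = 0
    have : elementMap (selfObj R κ) (0 : R) = 0 := by ext : 2; simp [elementMap]
    rw [this, op_zero, Functor.map_zero]; rfl

/-- The evaluation at `R`, as a functor `Mod C^κ ⥤ Mod R`. -/
def evalSelf : Modules (Presentable R κ) ⥤ ModuleCat.{u} R where
  obj M := @ModuleCat.of R _ (M.obj.obj (op (selfObj R κ))) _ (evalModule M)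
  map {M N} f :=
    letI := evalModule M
    letI := evalModule N
    ModuleCat.ofHom
      { toFun := (f.hom.app (op (selfObj R κ))).hom
        map_add' := map_add _
        map_smul' := fun r m ↦
          ConcreteCategory.congr_hom (f.hom.naturality (elementMap (selfObj R κ) r).op) m }

/-- The map `M ⟶ C(-, X)` corresponding to a linear map `M(R) ⟶ X`: it sends `m` in `M(N)` to
the linear map `n ↦ φ (M(n) m)`. -/
def toNerve {M : Modules (Presentable R κ)} {X : ModuleCat.{u} R}
    (φ : (evalSelf R κ).obj M ⟶ X) : M ⟶ (nerve R κ).obj X :=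
  ObjectProperty.homMk
    { app := fun N ↦ AddCommGrpCat.ofHom
        { toFun := fun m ↦ ModuleCat.ofHom
            { toFun := fun n ↦ φ.hom (M.obj.map (elementMap N.unop n).op m)
              map_add' := fun n n' ↦ by
                rw [elementMap_add, op_add, Functor.map_add]
                exact map_add φ.hom _ _
              map_smul' := fun r n ↦ by
                let := evalModule M
                have : elementMap N.unop (r • n) =
                    elementMap (selfObj R κ) r ≫ elementMap N.unop n := by
                  rw [elementMap_comp]; rfl
                rw [this, op_comp, Functor.map_comp]
                exact φ.hom.map_smul r (M.obj.map (elementMap N.unop n).op m) }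
          map_zero' := by
            refine ModuleCat.hom_ext (M := N.unop.obj) (LinearMap.ext fun n ↦ ?_)
            change φ.hom ((M.obj.map (elementMap N.unop n).op).hom 0) = 0
            rw [map_zero]
            exact map_zero φ.hom
          map_add' := fun m m' ↦ by
            refine ModuleCat.hom_ext (M := N.unop.obj) (LinearMap.ext fun n ↦ ?_)
            change φ.hom ((M.obj.map (elementMap N.unop n).op).hom (m + m')) = _
            rw [map_add]
            exact map_add φ.hom _ _ }
      naturality := fun N N' f ↦ by
        refine ConcreteCategory.hom_ext _ _ fun m ↦ ?_
        refine ModuleCat.hom_ext (M := N'.unop.obj) (N := X) (LinearMap.ext fun n ↦ ?_)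
        change φ.hom (M.obj.map (elementMap N'.unop n).op (M.obj.map f m)) =
          φ.hom (M.obj.map (elementMap N.unop (f.unop.hom n)).op m)
        rw [← elementMap_comp, op_comp, Functor.map_comp]
        rfl }

/-- The linear map `M(R) ⟶ X` corresponding to a map `M ⟶ C(-, X)`. -/
def ofNerve {M : Modules (Presentable R κ)} {X : ModuleCat.{u} R}
    (φ : M ⟶ (nerve R κ).obj X) : (evalSelf R κ).obj M ⟶ X :=
  letI := evalModule M
  ModuleCat.ofHom (X := M.obj.obj (op (selfObj R κ)))
    { toFun := fun m ↦ (show ModuleCat.of R R ⟶ X from φ.hom.app (op (selfObj R κ)) m) (1 : R)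
      map_add' := fun m m' ↦ by
        rw [map_add]
        rfl
      map_smul' := fun r m ↦ by
        have h := ConcreteCategory.congr_hom
          (φ.hom.naturality (elementMap (selfObj R κ) r).op) m
        have h' := congr_arg (fun ψ : ModuleCat.of R R ⟶ X ↦ ψ.hom (1 : R)) h
        refine h'.trans ?_
        change (show ModuleCat.of R R ⟶ X from φ.hom.app (op (selfObj R κ)) m).hom
          ((1 : R) • r : R) = _
        rw [one_smul]
        nth_rw 1 [← mul_one r]
        exact LinearMap.map_smul
          (show ModuleCat.of R R ⟶ X from φ.hom.app (op (selfObj R κ)) m).hom r (1 : R) }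

/-- The evaluation at `R` is left adjoint to the restricted Yoneda functor. -/
def evalSelfAdjunction : evalSelf R κ ⊣ nerve R κ :=
  Adjunction.mkOfHomEquiv
    { homEquiv := fun M X ↦
        { toFun := toNerve R κ
          invFun := ofNerve R κ
          left_inv := fun φ ↦ by
            refine ModuleCat.hom_ext (LinearMap.ext fun m ↦ ?_)
            change φ.hom (M.obj.map (elementMap (selfObj R κ) (1 : R)).op m) = φ.hom m
            rw [elementMap_one]
            exact congr_arg φ.hom (ConcreteCategory.congr_hom (M.obj.map_id _) m)
          right_inv := fun φ ↦ by
            ext N : 3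
            refine ConcreteCategory.hom_ext _ _ fun m ↦ ?_
            refine ModuleCat.hom_ext (M := N.unop.obj) (N := X) (LinearMap.ext fun n ↦ ?_)
            have h := ConcreteCategory.congr_hom
              (φ.hom.naturality (elementMap N.unop n).op) m
            have h' := congr_arg (fun ψ : ModuleCat.of R R ⟶ X ↦ ψ.hom (1 : R)) h
            refine h'.trans ?_
            change (show N.unop.obj ⟶ X from φ.hom.app N m).hom ((1 : R) • n) = _
            rw [one_smul] }
      homEquiv_naturality_left_symm := fun f g ↦ rfl
      homEquiv_naturality_right := fun f g ↦ rfl }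

instance : (nerve R κ).IsRightAdjoint := (evalSelfAdjunction R κ).isRightAdjoint

/-- The canonical functor `Mod C^κ ⥤ C`: the left adjoint of the restricted Yoneda functor. -/
def realization : Modules (Presentable R κ) ⥤ ModuleCat.{u} R := (nerve R κ).leftAdjoint

/-- The canonical functor `Mod C^κ ⥤ C` is left adjoint to the restricted Yoneda functor. -/
def realizationAdjunction : realization R κ ⊣ nerve R κ := Adjunction.ofIsRightAdjoint _

instance : (realization R κ).IsLeftAdjoint := (realizationAdjunction R κ).isLeftAdjoint

instance : PreservesFiniteLimits (evalSelf R κ) := by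
  have : PreservesFiniteLimits (AdditiveFunctor.forget (Presentable R κ)ᵒᵖ AddCommGrpCat.{u}) := by
    have := ObjectProperty.preservesKernels_ι
      (P := additiveFunctor (Presentable R κ)ᵒᵖ AddCommGrpCat.{u})
    exact Functor.preservesFiniteLimits_of_preservesKernels _
  have : PreservesFiniteLimits (evalSelf R κ ⋙ forget₂ _ AddCommGrpCat.{u}) :=
    inferInstanceAs (PreservesFiniteLimits
      (AdditiveFunctor.forget _ _ ⋙ (evaluation _ _).obj (op (selfObj R κ))))
  exact preservesFiniteLimits_of_reflects_of_preserves _ (forget₂ _ AddCommGrpCat.{u})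

instance : PreservesFiniteLimits (realization R κ) :=
  preservesFiniteLimits_of_natIso
    ((realizationAdjunction R κ).leftAdjointUniq (evalSelfAdjunction R κ)).symm

instance : (realization R κ).Additive := Functor.additive_of_preserves_binary_products _

/-! ### The quotient functor -/

variable [HasDerivedCategory.{w} (Modules (Presentable R κ))]
  [HasDerivedCategory.{w'} (ModuleCat.{u} R)]

/-- The functor `D(Mod C^κ) ⥤ D(C)` induced by the exact functor `Mod C^κ ⥤ C`. -/
def quotientFunctor : DerivedCategory (Modules (Presentable R κ)) ⥤
    DerivedCategory (ModuleCat.{u} R) :=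
  (realization R κ).mapDerivedCategory

instance : (quotientFunctor R κ).CommShift ℤ :=
  inferInstanceAs ((realization R κ).mapDerivedCategory.CommShift ℤ)

instance : (quotientFunctor R κ).IsTriangulated :=
  inferInstanceAs (realization R κ).mapDerivedCategory.IsTriangulated

/-- The functor `C^κ ⥤ Mod C^κ ⥤ D(Mod C^κ)`: the Yoneda embedding, followed by the inclusion of
`Mod C^κ` as the complexes concentrated in degree `0`. -/
def derivedYoneda : Presentable R κ ⥤ DerivedCategory (Modules (Presentable R κ)) :=
  yonedaModule (Presentable R κ) ⋙ DerivedCategory.singleFunctor _ 0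

/-- The class `S` of objects in the image of `C^κ ⥤ Mod C^κ ⥤ D(Mod C^κ)`. -/
def representables : ObjectProperty (DerivedCategory (Modules (Presentable R κ))) :=
  .ofObj (derivedYoneda R κ).obj

end

end WellGen

end

/-! The restricted Yoneda functor is fully faithful, because its left adjoint is evaluation at `R`
and `Hom(R, X) = X`. An exact functor `F` with a fully faithful right adjoint `G` is a localization,
and it stays one on complexes, where the adjunction acts degreewise. Inverting quasi-isomorphisms on
both sides gives the Verdier quotient (`Adjunction.isLocalization_mapDerivedCategory`), and the
counit isomorphism identifies the image of the representables with the presentable modules.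

The failure of (G2) comes from Bass's theorem: over a non-noetherian ring some direct sum of
injectives `E j` is not injective (`Ideal.exists_injective_not_extends`). Test (G2) on the maps `0 ⟶
(E j)[1]`. They are surjective on maps out of every module, since `Ext¹(A, E j) = 0`. Coproducts of
modules are exact, so the coproduct of the targets in the derived category is `(⨁ E j)[1]`; this is
the content of `DerivedCategory.isColimitMapCofan`. Thus (G2) would force `Ext¹(R ⧸ I, ⨁ E j) = 0`
for every ideal `I` with `R ⧸ I` in the class, and every map `I → ⨁ E j` would extend to `R`. All
cyclic modules lie in the class once `κ` exceeds the cardinality of `R`. -/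

noncomputable section

/-! ### Verdier quotients from exact functors with a fully faithful right adjoint. -/

namespace CategoryTheory

section

variable {C D : Type*} [Category* C] [Category* D] [Preadditive C] [Preadditive D]
  {F : C ⥤ D} {G : D ⥤ C} [F.Additive] [G.Additive]

/-- The adjunction on homological complexes induced by an adjunction between additive functors. -/
def Adjunction.mapHomologicalComplex (adj : F ⊣ G) {ι : Type*} (c : ComplexShape ι) :
    F.mapHomologicalComplex c ⊣ G.mapHomologicalComplex c where
  unit :=
    { app K := { f i := adj.unit.app (K.X i), comm' _ _ _ := (adj.unit.naturality _).symm }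
      naturality _ _ f := by ext n; exact adj.unit.naturality (f.f n) }
  counit :=
    { app K := { f i := adj.counit.app (K.X i), comm' _ _ _ := (adj.counit.naturality _).symm }
      naturality _ _ f := by ext n; exact adj.counit.naturality (f.f n) }
  left_triangle_components K := by ext n; exact adj.left_triangle_components (K.X n)
  right_triangle_components K := by ext n; exact adj.right_triangle_components (K.X n)

end

section

variable {A B : Type*} [Category* A] [Category* B] [Abelian A] [Abelian B]
  [HasDerivedCategory.{w} A] [HasDerivedCategory.{w'} B]
  (F : A ⥤ B) [F.Additive] [PreservesFiniteLimits F] [PreservesFiniteColimits F]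

/-- Every morphism in the derived category is isomorphic to the image of a morphism of cochain
complexes. -/
lemma _root_.DerivedCategory.exists_arrow_iso_Q_map {X Y : DerivedCategory A} (f : X ⟶ Y) :
    ∃ (X' Y' : CochainComplex A ℤ) (f' : X' ⟶ Y'),
      Nonempty (Arrow.mk (DerivedCategory.Q.map f') ≅ Arrow.mk f) := by
  let eX := DerivedCategory.Q.objObjPreimageIso X
  let eY := DerivedCategory.Q.objObjPreimageIso Y
  obtain ⟨X', s, hs, g, h⟩ := DerivedCategory.right_fac (eX.hom ≫ f ≫ eY.inv)
  refine ⟨X', _, g, ⟨Arrow.isoMk (asIso (DerivedCategory.Q.map s) ≪≫ eX) eY ?_⟩⟩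
  have : f = eX.inv ≫ (inv (DerivedCategory.Q.map s) ≫ DerivedCategory.Q.map g) ≫ eY.hom := by
    simp [← h]
  simp [this]

/-- A morphism has its cone in the kernel of a triangulated functor if and only if the functor
sends it to an isomorphism. -/
lemma trW_kernel_eq_inverseImage_isomorphisms {T T' : Type*} [Category* T] [Category* T']
    [HasZeroObject T] [HasZeroObject T'] [HasShift T ℤ] [HasShift T' ℤ]
    [Preadditive T] [Preadditive T'] [∀ n : ℤ, (shiftFunctor T n).Additive]
    [∀ n : ℤ, (shiftFunctor T' n).Additive] [Pretriangulated T] [Pretriangulated T']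
    (F : T ⥤ T') [F.CommShift ℤ] [F.IsTriangulated] :
    F.kernel.trW = (MorphismProperty.isomorphisms T').inverseImage F := by
  ext X Y f
  obtain ⟨Z, g, h, hT⟩ := Pretriangulated.distinguished_cocone_triangle f
  have h₁ := Pretriangulated.Triangle.isZero₃_iff_isIso₁ _ (F.map_distinguished _ hT)
  refine ⟨fun ⟨Z', g', h', hT', hZ'⟩ ↦
    (Pretriangulated.Triangle.isZero₃_iff_isIso₁ _ (F.map_distinguished _ hT')).1 hZ',
    fun hf ↦ ⟨Z, g, h, hT, h₁.2 hf⟩⟩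

/-- If an exact functor has a fully faithful right adjoint, then the induced functor on derived
categories is a Verdier quotient functor. -/
lemma Adjunction.isLocalization_mapDerivedCategory {G : B ⥤ A} [G.Additive] [G.Full] [G.Faithful]
    (adj : F ⊣ G) :
    F.mapDerivedCategory.IsLocalization F.mapDerivedCategory.kernel.trW := by
  let c := ComplexShape.up ℤ
  let adj' := adj.mapHomologicalComplex c
  let W₁ := (MorphismProperty.isomorphisms _).inverseImage (F.mapHomologicalComplex c)
  -- Both `F.mapHomologicalComplex c ⋙ Q` and `Q ⋙ F.mapDerivedCategory` are shown to be
  -- localizations at `W₃`; cancelling the first `Q` then gives the claim.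
  let W₃ := (HomologicalComplex.quasiIso B c).inverseImage (F.mapHomologicalComplex c)
  have : IsIso adj'.counit := by
    have (K : HomologicalComplex B c) : IsIso (adj'.counit.app K) := by
      have (i : ℤ) : IsIso ((adj'.counit.app K).f i) :=
        inferInstanceAs (IsIso (adj.counit.app (K.X i)))
      exact HomologicalComplex.Hom.isIso_of_components _
    exact NatIso.isIso_of_isIso_app _
  have := adj'.fullyFaithfulROfIsIsoCounit
  have := this.full
  have := adj'.fullyFaithfulROfIsIsoCounit.faithful
  have : (F.mapHomologicalComplex c).IsLocalization W₁ := adj'.isLocalization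
  have h₃ : W₃.IsInvertedBy (F.mapHomologicalComplex c ⋙ DerivedCategory.Q) := fun X Y f hf ↦
    Localization.inverts DerivedCategory.Q (HomologicalComplex.quasiIso B c) _ hf
  have : (F.mapHomologicalComplex c ⋙ DerivedCategory.Q).IsLocalization W₃ := by
    refine Functor.IsLocalization.comp _ _ W₁ (HomologicalComplex.quasiIso B c) W₃ h₃ ?_ ?_
    · intro X Y f hf
      have : IsIso ((F.mapHomologicalComplex c).map f) := hf
      change HomologicalComplex.quasiIso B c _
      rw [HomologicalComplex.mem_quasiIso_iff]
      infer_instance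
    -- `G` need not be exact, so `G f` need not be a quasi-isomorphism. Still `F (G f) ≅ f` by the
    -- counit, so `G f` lies in `W₃`, which is enough.
    · intro X Y f hf
      let e : Arrow.mk ((F.mapHomologicalComplex c).map ((G.mapHomologicalComplex c).map f)) ≅
        Arrow.mk f := Arrow.isoMk (asIso (adj'.counit.app X)) (asIso (adj'.counit.app Y))
      refine ((W₃.map _).arrow_mk_iso_iff e).1 (MorphismProperty.map_mem_map _ _ _ ?_)
      exact ((HomologicalComplex.quasiIso B c).arrow_mk_iso_iff e).2 hf
  have : (DerivedCategory.Q ⋙ F.mapDerivedCategory).IsLocalization W₃ :=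
    Functor.IsLocalization.of_iso _ F.mapDerivedCategoryFactors.symm
  refine Functor.IsLocalization.of_comp DerivedCategory.Q F.mapDerivedCategory
    (HomologicalComplex.quasiIso A c) _ W₃ ?_ ?_
  · intro X Y f hf
    have : QuasiIso f := hf
    change QuasiIso _
    infer_instance
  · rw [trW_kernel_eq_inverseImage_isomorphisms]
    apply le_antisymm
    · intro X Y f hf
      obtain ⟨X', Y', f', ⟨e⟩⟩ := DerivedCategory.exists_arrow_iso_Q_map f
      refine ((W₃.map _).arrow_mk_iso_iff e).1 (MorphismProperty.map_mem_map _ _ _ ?_)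
      have h₁ : IsIso (F.mapDerivedCategory.map (DerivedCategory.Q.map f')) :=
        (((MorphismProperty.isomorphisms _).inverseImage _).arrow_mk_iso_iff e).2 hf
      have : IsIso (DerivedCategory.Q.map ((F.mapHomologicalComplex c).map f')) :=
        ((MorphismProperty.isomorphisms _).arrow_mk_iso_iff
          (((Functor.mapArrowFunctor _ _).mapIso F.mapDerivedCategoryFactors).app
            (Arrow.mk f'))).1 h₁
      exact by
        rwa [DerivedCategory.isIso_Q_map_iff_quasiIso] at this
    · rw [MorphismProperty.map_le_iff]
      exact fun X Y f hf ↦ Localization.inverts (DerivedCategory.Q ⋙ F.mapDerivedCategory) W₃ _ hf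

end

end CategoryTheory
-- Exact coproducts pass to the derived category.
namespace CochainComplex

variable {C : Type*} [Category* C] [Abelian C] {I : Type*}
  [HasCoproductsOfShape I C] [HasExactColimitsOfShape (Discrete I) C]

/-- Coproducts of quasi-isomorphisms are quasi-isomorphisms when coproducts are exact. -/
lemma quasiIso_desc {X Y : I → CochainComplex C ℤ} (f : ∀ i, X i ⟶ Y i) [∀ i, QuasiIso (f i)]
    {cX : Cofan X} (hX : IsColimit cX) {cY : Cofan Y} (hY : IsColimit cY) :
    QuasiIso (Cofan.IsColimit.desc hX (fun i ↦ f i ≫ cY.inj i)) := by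
  -- A family of complexes is one complex in `Discrete I ⥤ C`. Quasi-isomorphisms there are detected
  -- pointwise, and the exact functor `colim` preserves them.
  let K (X : I → CochainComplex C ℤ) : HomologicalComplex (Discrete I ⥤ C) (ComplexShape.up ℤ) :=
    { X n := Discrete.functor (fun i ↦ (X i).X n)
      d n m := Discrete.natTrans (fun i ↦ (X i.as).d n m)
      shape n m h := by ext ⟨i⟩; exact (X i).shape n m h
      d_comp_d' n m k _ _ := by ext ⟨i⟩; exact (X i).d_comp_d n m k }
  let φ : K X ⟶ K Y :=
    { f n := Discrete.natTrans (fun i ↦ (f i.as).f n)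
      comm' n m _ := by ext ⟨i⟩; exact (f i).comm n m }
  have : QuasiIso φ := by
    rw [HomologicalComplex.quasiIso_iff_evaluation]
    exact fun ⟨i⟩ ↦ inferInstanceAs (QuasiIso (f i))
  have : (colim : (Discrete I ⥤ C) ⥤ C).Additive :=
    Functor.additive_of_preserves_binary_products _
  let h (Z : I → CochainComplex C ℤ) (c : Cofan Z) (hc : IsColimit c) (n : ℤ) :
      IsColimit (Cofan.mk (f := fun i ↦ (Z i).X n) (c.pt.X n) (fun i ↦ (c.inj i).f n)) :=
    isColimitCofanMkObjOfIsColimit (HomologicalComplex.eval C _ n) _ _ hc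
  let inj (Z : I → CochainComplex C ℤ) (n : ℤ) (i : I) :
      (Z i).X n ⟶ ((colim.mapHomologicalComplex _).obj (K Z)).X n :=
    colimit.ι ((K Z).X n) ⟨i⟩
  let e₀ (Z : I → CochainComplex C ℤ) (c : Cofan Z) (hc : IsColimit c) (n : ℤ) :
      ((colim.mapHomologicalComplex _).obj (K Z)).X n ≅ c.pt.X n :=
    (colimit.isColimit _).coconePointUniqueUpToIso (h Z c hc n)
  have he₀ (Z : I → CochainComplex C ℤ) (c : Cofan Z) (hc : IsColimit c) (n : ℤ) (i : I) :
      inj Z n i ≫ (e₀ Z c hc n).hom = (c.inj i).f n :=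
    (colimit.isColimit _).comp_coconePointUniqueUpToIso_hom (h Z c hc n) ⟨i⟩
  have hd (Z : I → CochainComplex C ℤ) (n m : ℤ) (i : I) :
      inj Z n i ≫ ((colim.mapHomologicalComplex _).obj (K Z)).d n m = (Z i).d n m ≫ inj Z m i :=
    ι_colimMap _ _
  have hφ (n : ℤ) (i : I) :
      inj X n i ≫ ((colim.mapHomologicalComplex _).map φ).f n =
      (f i).f n ≫ inj Y n i :=
    ι_colimMap _ _
  let e (Z : I → CochainComplex C ℤ) (c : Cofan Z) (hc : IsColimit c) :
      (colim.mapHomologicalComplex _).obj (K Z) ≅ c.pt :=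
    HomologicalComplex.Hom.isoOfComponents (fun n ↦ e₀ Z c hc n)
      (fun n m _ ↦ colimit.hom_ext fun ⟨i⟩ ↦ by
        have := he₀ Z c hc n i =≫ c.pt.d n m
        rw [Category.assoc, (c.inj i).comm, ← he₀ Z c hc m i, ← reassoc_of% (hd Z n m i)] at this
        exact this)
  have : Arrow.mk ((colim.mapHomologicalComplex _).map φ) ≅
      Arrow.mk (Cofan.IsColimit.desc hX (fun i ↦ f i ≫ cY.inj i)) :=
    Arrow.isoMk (e X cX hX) (e Y cY hY) (by
      ext n
      refine colimit.hom_ext fun ⟨i⟩ ↦ ?_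
      have h₃ := HomologicalComplex.congr_hom
        (Cofan.IsColimit.fac hX (fun i ↦ f i ≫ cY.inj i) i) n
      rw [HomologicalComplex.comp_f, HomologicalComplex.comp_f, ← he₀ X cX hX, ← he₀ Y cY hY, Category.assoc,
        ← reassoc_of% (hφ n i)] at h₃
      exact h₃)
  exact ((HomologicalComplex.quasiIso C _).arrow_mk_iso_iff this).1
    (inferInstanceAs (QuasiIso ((colim.mapHomologicalComplex _).map φ)))

end CochainComplex

namespace DerivedCategory

variable {C : Type*} [Category* C] [Abelian C] [HasDerivedCategory.{w} C] {I : Type*}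

/-- A morphism of complexes which vanishes in the derived category becomes homotopic to zero after
precomposition with a quasi-isomorphism. -/
lemma exists_homotopy_of_Q_map_eq_zero {X Y : CochainComplex C ℤ} (f : X ⟶ Y) (hf : Q.map f = 0) :
    ∃ (X' : CochainComplex C ℤ) (s : X' ⟶ X) (_ : QuasiIso s), Nonempty (Homotopy (s ≫ f) 0) := by
  have h : Qh.map ((HomotopyCategory.quotient _ _).map f) =
      Qh.map ((HomotopyCategory.quotient _ _).map 0) := by
    have e := (quotientCompQhIso C).hom.naturality f
    rw [hf, comp_zero] at e
    simpa [← cancel_mono ((quotientCompQhIso C).hom.app Y)] using e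
  obtain ⟨X', s, hs, h'⟩ := (MorphismProperty.map_eq_iff_precomp Qh
    (HomotopyCategory.quasiIso C (.up ℤ)) _ _).1 h
  obtain ⟨X', rfl⟩ := HomotopyCategory.quotient_obj_surjective X'
  obtain ⟨s, rfl⟩ := (HomotopyCategory.quotient _ _).map_surjective s
  refine ⟨X', s, ?_, ⟨HomotopyCategory.homotopyOfEq _ _ ?_⟩⟩
  · rwa [HomotopyCategory.quotient_map_mem_quasiIso_iff] at hs
  · simpa using h'

variable [HasCoproductsOfShape I C] [HasExactColimitsOfShape (Discrete I) C]

/-- A family of null-homotopic maps induces the zero map from the coproduct in the derived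
category. -/
lemma Q_map_desc_eq_zero {X : I → CochainComplex C ℤ} {c : Cofan X} (hc : IsColimit c)
    {Y : CochainComplex C ℤ} (f : ∀ i, X i ⟶ Y) (h : ∀ i, Homotopy (f i) 0) :
    Q.map (Cofan.IsColimit.desc hc f) = 0 := by
  -- Homotopies are maps out of cylinders, so they are glued on the coproduct of the cylinders. Its
  -- two end inclusions are sections of one quasi-isomorphism `p`, hence agree in the derived
  -- category.
  obtain ⟨c', ⟨cyl⟩⟩ : ∃ c' : Cofan (fun i ↦ (X i).cylinder), Nonempty (IsColimit c') :=
    ⟨_, ⟨coproductIsCoproduct _⟩⟩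
  let i₀ := Cofan.IsColimit.desc hc
    (fun i ↦ HomologicalComplex.cylinder.ι₀ (X i) ≫ c'.inj i)
  let i₁ := Cofan.IsColimit.desc hc
    (fun i ↦ HomologicalComplex.cylinder.ι₁ (X i) ≫ c'.inj i)
  let p := Cofan.IsColimit.desc cyl (fun i ↦ HomologicalComplex.cylinder.π (X i) ≫ c.inj i)
  let d := Cofan.IsColimit.desc cyl (fun i ↦ HomologicalComplex.cylinder.desc _ _ (h i))
  have hi : ∀ i, QuasiIso (HomologicalComplex.cylinder.π (X i)) := fun i ↦
    homotopyEquivalences_le_quasiIso _ _ _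
      ⟨HomologicalComplex.cylinder.homotopyEquiv (X i) (fun j ↦ ⟨j - 1, by simp⟩), rfl⟩
  have : QuasiIso p := CochainComplex.quasiIso_desc _ cyl hc
  have h₀ : i₀ ≫ p = 𝟙 _ := Cofan.IsColimit.hom_ext hc _ _ (fun i ↦ by simp [i₀, p])
  have h₁ : i₁ ≫ p = 𝟙 _ := Cofan.IsColimit.hom_ext hc _ _ (fun i ↦ by simp [i₁, p])
  have h₂ : i₀ ≫ d = Cofan.IsColimit.desc hc f :=
    Cofan.IsColimit.hom_ext hc _ _ (fun i ↦ by simp [i₀, d])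
  have h₃ : i₁ ≫ d = 0 := Cofan.IsColimit.hom_ext hc _ _ (fun i ↦ by simp [i₁, d])
  have h₄ : Q.map i₀ = Q.map i₁ := by
    rw [← cancel_mono (Q.map p), ← Q.map_comp, ← Q.map_comp, h₀, h₁]
  rw [← h₂, Q.map_comp, h₄, ← Q.map_comp, h₃, Q.map_zero]

/-- Uniqueness half of the universal property. A left fraction puts a single denominator on the
target; the quasi-isomorphisms killing the restrictions then assemble into one quasi-isomorphism
onto the coproduct, which can be cancelled. -/
lemma eq_zero_of_isColimit {X : I → CochainComplex C ℤ} {c : Cofan X} (hc : IsColimit c)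
    {Y : CochainComplex C ℤ} (f : Q.obj c.pt ⟶ Q.obj Y)
    (h : ∀ i, Q.map (c.inj i) ≫ f = 0) : f = 0 := by
  obtain ⟨Y', g, s, _, rfl⟩ := left_fac f
  have hg (i : I) : Q.map (c.inj i ≫ g) = 0 := by
    rw [← cancel_mono (inv (Q.map s)), zero_comp, Q.map_comp, Category.assoc, h]
  choose X' t ht H using fun i ↦ exists_homotopy_of_Q_map_eq_zero _ (hg i)
  obtain ⟨c', ⟨hc'⟩⟩ : ∃ c' : Cofan X', Nonempty (IsColimit c') := ⟨_, ⟨coproductIsCoproduct _⟩⟩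
  have := CochainComplex.quasiIso_desc t hc' hc
  have h₀ := Q_map_desc_eq_zero hc' _ (fun i ↦ (H i).some)
  have h₁ : Cofan.IsColimit.desc hc' (fun i ↦ t i ≫ c.inj i ≫ g) =
      Cofan.IsColimit.desc hc' (fun i ↦ t i ≫ c.inj i) ≫ g :=
    Cofan.IsColimit.hom_ext hc' _ _ (fun i ↦ by simp)
  rw [h₁, Q.map_comp] at h₀
  rw [← cancel_epi (Q.map (Cofan.IsColimit.desc hc'
    (fun i ↦ t i ≫ c.inj i))), reassoc_of% h₀, zero_comp, comp_zero]

/-- Existence half. Right fractions put the denominators on the sources, where their coproduct is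
again a quasi-isomorphism. -/
lemma exists_desc_of_isColimit {X : I → CochainComplex C ℤ} {c : Cofan X} (hc : IsColimit c)
    {Y : CochainComplex C ℤ} (f : ∀ i, Q.obj (X i) ⟶ Q.obj Y) :
    ∃ φ : Q.obj c.pt ⟶ Q.obj Y, ∀ i, Q.map (c.inj i) ≫ φ = f i := by
  choose X' s hs g hg using fun i ↦ right_fac (f i)
  have (i : I) : QuasiIso (s i) := by
    simpa only [isIso_Q_map_iff_quasiIso] using hs i
  obtain ⟨c', ⟨hc'⟩⟩ : ∃ c' : Cofan X', Nonempty (IsColimit c') := ⟨_, ⟨coproductIsCoproduct _⟩⟩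
  have := CochainComplex.quasiIso_desc s hc' hc
  refine ⟨inv (Q.map (Cofan.IsColimit.desc hc' (fun i ↦ s i ≫ c.inj i))) ≫
    Q.map (Cofan.IsColimit.desc hc' g), fun i ↦ ?_⟩
  have h₁ := Q.congr_map (Cofan.IsColimit.fac hc'
    (fun i ↦ s i ≫ c.inj i) i)
  have h₂ := Q.congr_map (Cofan.IsColimit.fac hc' g i)
  rw [Q.map_comp, Q.map_comp] at h₁
  rw [Q.map_comp] at h₂
  rw [hg, ← cancel_epi (Q.map (s i)), ← reassoc_of% h₁, IsIso.hom_inv_id_assoc,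
    IsIso.hom_inv_id_assoc, h₂]

/-- The functor from cochain complexes to the derived category preserves coproducts when
coproducts are exact. -/
def isColimitMapCofan {X : I → CochainComplex C ℤ} {c : Cofan X} (hc : IsColimit c) :
    IsColimit (Cofan.mk (f := fun i ↦ (Q.obj (X i) : DerivedCategory C)) (Q.obj c.pt)
      (fun i ↦ Q.map (c.inj i))) :=
  have h (s : Cofan (fun i ↦ (Q.obj (X i) : DerivedCategory C))) :
      ∃ φ : Q.obj c.pt ⟶ s.pt, ∀ i, Q.map (c.inj i) ≫ φ = s.inj i := by
    let e := Q.objObjPreimageIso s.pt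
    obtain ⟨φ, hφ⟩ := exists_desc_of_isColimit hc (fun i ↦ s.inj i ≫ e.inv)
    exact ⟨φ ≫ e.hom, fun i ↦ by simp [reassoc_of% (hφ i)]⟩
  Cofan.IsColimit.mk _ (fun s ↦ (h s).choose) (fun s ↦ (h s).choose_spec) (fun s m hm ↦ by
    let e := Q.objObjPreimageIso s.pt
    rw [← sub_eq_zero, ← cancel_mono e.inv, zero_comp]
    refine eq_zero_of_isColimit hc _ (fun i ↦ ?_)
    have := hm i
    have h' := (h s).choose_spec i
    dsimp at this h'
    rw [← Category.assoc, Preadditive.comp_sub, h', this, sub_self, zero_comp])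

end DerivedCategory
-- Bass's counterexample and presentability of cyclic modules.
namespace Ideal

variable {R : Type u} [CommRing R]

/-- For a sequence of linear maps on `R` such that each element of the ideal `I` is killed by
almost all of them, the induced linear map from `I` to the direct sum. -/
lemma exists_linearMap_directSum {J : Type v} {E : J → Type w} [∀ j, AddCommGroup (E j)]
    [∀ j, Module R (E j)] (p : ∀ j, R →ₗ[R] E j) (I : Ideal R)
    (hI : ∀ x ∈ I, {j | p j x ≠ 0}.Finite) :
    ∃ g : I →ₗ[R] DirectSum J E, ∀ (x : I) (j : J), g x j = p j x := by
  classical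
  have h (x : I) : ∃ y : DirectSum J E, ∀ j, y j = p j x := by
    refine ⟨DFinsupp.mk (hI x x.2).toFinset (fun j ↦ p j x), fun j ↦ ?_⟩
    by_cases hj : p j x = 0
    · exact (DFinsupp.mk_of_notMem (by simpa using hj)).trans hj.symm
    · exact DFinsupp.mk_of_mem (by simpa using hj)
  choose g hg using h
  refine ⟨{ toFun := g, map_add' := fun x y ↦ ?_, map_smul' := fun r x ↦ ?_ }, hg⟩
  · refine DFinsupp.ext fun j ↦ ?_
    rw [DirectSum.add_apply, hg, hg, hg]
    simp
  · refine DFinsupp.ext fun j ↦ ?_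
    refine (hg _ j).trans ?_
    rw [RingHom.id_apply, DirectSum.smul_apply, hg]
    exact (p j).map_smul r x

/-- Over a ring which is not noetherian, there is a countable family of injective modules whose
direct sum is not injective, as witnessed by a linear map from an ideal which does not extend. -/
lemma exists_injective_not_extends (hR : ¬ IsNoetherianRing R) :
    ∃ (E : ULift.{u} ℕ → ModuleCat.{u} R) (_ : ∀ j, Injective (E j)) (I : Ideal R)
      (g : I →ₗ[R] DirectSum (ULift.{u} ℕ) (fun j ↦ E j)),
      ∀ g' : R →ₗ[R] DirectSum (ULift.{u} ℕ) (fun j ↦ E j), g' ∘ₗ I.subtype ≠ g := by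
  classical
  rw [isNoetherianRing_iff, ← monotone_stabilizes_iff_noetherian] at hR
  push Not at hR
  obtain ⟨f, hf⟩ := hR
  -- Embed each `R ⧸ f j` in an injective `E j`. An element of the union of the chain dies in almost
  -- all quotients, so it has an image in the direct sum.
  let E (j : ULift.{u} ℕ) : ModuleCat.{u} R := Injective.under (ModuleCat.of R (R ⧸ f j.down))
  let p (j : ULift.{u} ℕ) : R →ₗ[R] E j :=
    (Injective.ι (ModuleCat.of R (R ⧸ f j.down))).hom ∘ₗ (f j.down).mkQ
  have hp (j : ULift.{u} ℕ) (x : R) : p j x = 0 ↔ x ∈ f j.down := by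
    have := (ModuleCat.mono_iff_injective (Injective.ι (ModuleCat.of R (R ⧸ f j.down)))).1
      inferInstance
    refine (map_eq_zero_iff (Injective.ι (ModuleCat.of R (R ⧸ f j.down))).hom this).trans ?_
    exact Submodule.Quotient.mk_eq_zero _
  obtain ⟨g, hg⟩ := exists_linearMap_directSum p (⨆ n, f n) (fun x hx ↦ by
    obtain ⟨n, hn⟩ := (Submodule.mem_iSup_of_directed _ f.monotone.directed_le).1 hx
    refine ((Set.finite_lt_nat n).image ULift.up).subset fun j hj ↦ ⟨j.down, ?_, rfl⟩
    by_contra h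
    exact hj ((hp j x).2 (f.monotone (not_lt.1 h) hn)))
  refine ⟨E, fun j ↦ inferInstance, ⨆ n, f n, g, fun g' hg' ↦ ?_⟩
  -- An extension is multiplication by `g' 1`, which has finite support. Its vanishing in coordinate
  -- `n` puts the whole union inside `f n`, so the chain stabilizes.
  obtain ⟨n, hn⟩ : ∃ n : ℕ, ∀ m, n ≤ m → g' 1 ⟨m⟩ = 0 := by
    obtain ⟨n, hn⟩ := ((DFinsupp.support (g' 1)).image ULift.down).bddAbove
    refine ⟨n + 1, fun m hm ↦ ?_⟩
    by_contra h
    have : m ≤ n := hn (by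
      simpa using h)
    lia
  obtain ⟨m, hm, hne⟩ := hf n
  refine hne (le_antisymm (f.monotone hm) fun x hx ↦ ?_)
  have hx' : x ∈ ⨆ n, f n := le_iSup f m hx
  rw [← hp ⟨n⟩, ← hg ⟨x, hx'⟩, ← hg']
  have : g' x = x • g' 1 := by rw [← map_smul, smul_eq_mul, mul_one]
  change g' x ⟨n⟩ = 0
  rw [this, DirectSum.smul_apply, hn n le_rfl, smul_zero]

/-- A linear map from an ideal `I` to `M` extends to the ring if `Ext¹(R ⧸ I, M)` vanishes. -/
lemma exists_extension_of_subsingleton_ext (I : Ideal R) (M : ModuleCat.{u} R)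
    [Subsingleton (Abelian.Ext.{u} (ModuleCat.of R (R ⧸ I)) M 1)] (g : I →ₗ[R] M) :
    ∃ g' : R →ₗ[R] M, g' ∘ₗ I.subtype = g := by
  have hS := ModuleCat.shortComplex_shortExact
    (ShortComplex.mk (ModuleCat.ofHom I.subtype) (ModuleCat.ofHom (Submodule.mkQ I)) (by
      ext x; exact (Submodule.Quotient.mk_eq_zero _).2 x.2))
    (by
      intro x
      simp [Ideal.Quotient.eq_zero_iff_mem])
    I.subtype_injective (Submodule.mkQ_surjective _)
  -- The obstruction to extending `g` is its image under the connecting map to `Ext¹(R ⧸ I, M)`.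
  obtain ⟨x, hx⟩ := Abelian.Ext.contravariant_sequence_exact₁ hS M
    (Abelian.Ext.mk₀ (ModuleCat.ofHom g)) (add_zero 1) (Subsingleton.elim _ _)
  obtain ⟨g', rfl⟩ := (Abelian.Ext.mk₀_bijective _ _).2 x
  rw [Abelian.Ext.mk₀_comp_mk₀] at hx
  have := (Abelian.Ext.mk₀_bijective _ _).1 hx
  exact ⟨g'.hom, congr_arg ModuleCat.Hom.hom this⟩

/-- The quotient of `R` by an ideal of cardinality less than `κ` is `κ`-presentable. -/
lemma isCardinalPresentable_quotient (I : Ideal R) (κ : Cardinal.{u}) [Fact κ.IsRegular]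
    (hI : Cardinal.mk I < κ) : IsCardinalPresentable (ModuleCat.of R (R ⧸ I)) κ := by
  have h₀ : Cardinal.aleph0 ≤ κ := (Fact.out : κ.IsRegular).aleph0_le
  -- All elements of `I` serve as generators: `R ⧸ I` is the cokernel of `⨁_{x ∈ I} R ⟶ R`, built
  -- from copies of `R` by `κ`-small colimits.
  let X (_ : I) : ModuleCat.{u} R := ModuleCat.of R R
  let φ : ∐ X ⟶ ModuleCat.of R R :=
    Sigma.desc (fun x ↦ ModuleCat.ofHom (LinearMap.toSpanSingleton R R (x : R)))
  have hX : IsCardinalPresentable (∐ X) κ := by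
    have (k : Discrete I) : IsCardinalPresentable ((Discrete.functor X).obj k) κ :=
      WellGen.isCardinalPresentable_self R κ
    exact isCardinalPresentable_of_isColimit _ (colimit.isColimit (Discrete.functor X)) κ
      (by 
        rwa [hasCardinalLT_iff_of_equiv (Arrow.discreteEquiv I), hasCardinalLT_iff_cardinal_mk_lt])
  have w : φ ≫ ModuleCat.ofHom (Submodule.mkQ I) = 0 := by
    refine Sigma.hom_ext _ _ fun x ↦ ?_
    ext
    simp [φ, Ideal.Quotient.eq_zero_iff_mem]
  have hw : IsColimit (CokernelCofork.ofπ (ModuleCat.ofHom (Submodule.mkQ I)) w) :=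
    CokernelCofork.IsColimit.ofπ _ _
      (fun f hf ↦ ModuleCat.ofHom (Submodule.liftQ I f.hom (fun x hx ↦ by
        have := Sigma.ι X ⟨x, hx⟩ ≫= hf
        have := congr_arg (fun ψ : ModuleCat.of R R ⟶ _ ↦ ψ.hom (1 : R)) this
        simpa [φ] using this)))
      (fun f hf ↦ by ext; simp)
      (fun f hf m hm ↦ by
        ext
        simp [← hm])
  have (k : WalkingParallelPair) : IsCardinalPresentable ((parallelPair φ 0).obj k) κ := by
    cases k
    · exact hX
    · exact WellGen.isCardinalPresentable_self R κ
  exact isCardinalPresentable_of_isColimit _ hw κ (hasCardinalLT_of_finite _ _ h₀)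

end Ideal
-- Failure of (G2) over a non-noetherian ring.
namespace DerivedCategory

/-- The shift of the coproduct of a family of objects, placed in degree `0`, is a coproduct in the
derived category. -/
def isColimitSingleFunctorShift {C : Type*} [Category* C] [Abelian C] [HasDerivedCategory.{w} C]
    {J : Type*} [HasCoproductsOfShape J C] [HasExactColimitsOfShape (Discrete J) C]
    {E : J → C} {c : Cofan E} (hc : IsColimit c) (n : ℤ) :
    IsColimit (Cofan.mk (f := fun j ↦ ((singleFunctor C 0).obj (E j))⟦n⟧)
      (((singleFunctor C 0).obj c.pt)⟦n⟧) (fun j ↦ ((singleFunctor C 0).map (c.inj j))⟦n⟧')) :=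
  let h₀ : IsColimit (Cofan.mk c.pt c.inj) := hc.ofIsoColimit (Cofan.ext (Iso.refl _))
  let h₁ := isColimitCofanMkObjOfIsColimit
    (HomologicalComplex.single C (ComplexShape.up ℤ) 0) _ _ h₀
  isColimitCofanMkObjOfIsColimit (shiftFunctor (DerivedCategory C) n) _ _ (isColimitMapCofan h₁)

end DerivedCategory

namespace WellGen

variable {R : Type u} [CommRing R]

open scoped ZeroObject in
/-- If `R` is not noetherian, a class of modules which contains all cyclic modules, placed in
degree `0`, does not satisfy (G2) in the derived category. -/
lemma not_satisfiesG2 [HasDerivedCategory.{w'} (ModuleCat.{u} R)] (hR : ¬ IsNoetherianRing R)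
    (S : ObjectProperty (DerivedCategory (ModuleCat.{u} R)))
    (hS : ∀ s, S s → ∃ A : ModuleCat.{u} R,
      Nonempty (s ≅ (DerivedCategory.singleFunctor _ 0).obj A))
    (hS' : ∀ I : Ideal R, ∃ s, S s ∧
      Nonempty (s ≅ (DerivedCategory.singleFunctor _ 0).obj (ModuleCat.of R (R ⧸ I)))) :
    ¬ SatisfiesG2.{w', u, u + 1} S := by
  intro h
  obtain ⟨E, hE, I, g, hg⟩ := Ideal.exists_injective_not_extends hR
  let M := (ModuleCat.coproductCocone E).pt
  suffices Subsingleton (Abelian.Ext.{u} (ModuleCat.of R (R ⧸ I)) M 1) by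
    obtain ⟨g', hg'⟩ := Ideal.exists_extension_of_subsingleton_ext I M g
    exact hg g' hg'
  let Y (j : ULift.{u} ℕ) : DerivedCategory (ModuleCat.{u} R) :=
    ((DerivedCategory.singleFunctor _ 0).obj (E j))⟦((1 : ℕ) : ℤ)⟧
  have hY := DerivedCategory.isColimitSingleFunctorShift
    (ModuleCat.coproductCoconeIsColimit E) ((1 : ℕ) : ℤ)
  obtain ⟨s, hs, ⟨e⟩⟩ := hS' I
  -- Surjectivity out of a zero group means that the target vanishes; here the target is `Ext¹(A, E
  -- j)` with `E j` injective.
  have hsur (j : ULift.{u} ℕ) (s : DerivedCategory (ModuleCat.{u} R)) (hs : S s) :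
      Function.Surjective (fun g : s ⟶ 0 ↦ g ≫ (0 : 0 ⟶ Y j)) := by
    intro f
    obtain ⟨A, ⟨e⟩⟩ := hS s hs
    have : Subsingleton (Abelian.Ext.{u} A (E j) 1) := Abelian.Ext.subsingleton_of_injective A (E j) 0
    have := (Abelian.Ext.homEquiv (X := A) (Y := E j) (n := 1)).symm.subsingleton
    refine ⟨0, ?_⟩
    rw [← cancel_epi e.inv]
    exact this.elim _ _
  have h₀ : IsColimit (Cofan.mk (f := fun _ : ULift.{u} ℕ ↦ (0 : DerivedCategory (ModuleCat.{u} R)))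
      0 (fun _ ↦ 0)) :=
    Cofan.IsColimit.mk _ (fun _ ↦ 0) (fun _ _ ↦ (isZero_zero _).eq_of_src _ _)
      (fun _ _ _ ↦ (isZero_zero _).eq_of_src _ _)
  have := h _ _ _ _ hsur _ h₀ _ hY s hs
  have : Subsingleton
      (s ⟶ ((DerivedCategory.singleFunctor _ 0).obj M)⟦((1 : ℕ) : ℤ)⟧) := ⟨fun a b ↦ by
    obtain ⟨a, rfl⟩ := this a
    obtain ⟨b, rfl⟩ := this b
    rw [(isZero_zero _).eq_of_tgt a b]⟩
  exact ((Abelian.Ext.homEquiv (Y := M)).trans (e.symm.homCongr (Iso.refl _))).subsingleton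

/-! ### The quotient functor on representables, and the theorem. -/

variable (R) (κ : Cardinal.{u}) [Fact κ.IsRegular]

/-- The counit at `X` is the bijection `Hom(R, X) → X` evaluating at `1`. Full faithfulness of
`nerve` follows. -/
instance : IsIso (evalSelfAdjunction R κ).counit := by
  have (X : ModuleCat.{u} R) : IsIso ((evalSelfAdjunction R κ).counit.app X) := by
    rw [ConcreteCategory.isIso_iff_bijective]
    have : (evalSelfAdjunction R κ).counit.app X = ofNerve R κ (𝟙 _) := by
      simp [evalSelfAdjunction]
    rw [this]
    exact ((ModuleCat.homEquiv (M := ModuleCat.of R R) (N := X)).trans (LinearMap.ringLmapEquivSelf R R X).toEquiv).bijective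
  exact NatIso.isIso_of_isIso_app _

instance : (nerve R κ).Full := (evalSelfAdjunction R κ).fullyFaithfulROfIsIsoCounit.full

instance : (nerve R κ).Faithful := (evalSelfAdjunction R κ).fullyFaithfulROfIsIsoCounit.faithful

instance : (nerve R κ).Additive := (realizationAdjunction R κ).right_adjoint_additive

variable [HasDerivedCategory.{w} (Modules (Presentable R κ))]
  [HasDerivedCategory.{w'} (ModuleCat.{u} R)]

/-- The Yoneda embedding is the restriction of the restricted Yoneda functor. -/
def yonedaModuleIso : yonedaModule (Presentable R κ) ≅
    (isCardinalPresentable (ModuleCat.{u} R) κ).ι ⋙ nerve R κ :=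
  NatIso.ofComponents (fun A ↦ ObjectProperty.isoMk _ (NatIso.ofComponents (fun N ↦
    AddEquiv.toAddCommGrpIso (X := AddCommGrpCat.of (N.unop ⟶ A))
      (Y := AddCommGrpCat.of (N.unop.obj ⟶ A.obj))
      { ObjectProperty.fullyFaithfulι _ |>.homEquiv with
        map_add' _ _ := rfl }) (fun _ ↦ rfl))) (fun _ ↦ rfl)

/-- The composition of the Yoneda embedding with the quotient functor is the inclusion. -/
def derivedYonedaCompQuotientFunctorIso : derivedYoneda R κ ⋙ quotientFunctor R κ ≅
    (isCardinalPresentable (ModuleCat.{u} R) κ).ι ⋙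
      DerivedCategory.singleFunctor (ModuleCat.{u} R) 0 :=
  Functor.associator _ _ _ ≪≫
    Functor.isoWhiskerLeft _ ((realization R κ).mapDerivedCategorySingleFunctor 0) ≪≫
    (Functor.associator _ _ _).symm ≪≫
    Functor.isoWhiskerRight (Functor.isoWhiskerRight (yonedaModuleIso R κ) _ ≪≫
      Functor.associator _ _ _ ≪≫
      Functor.isoWhiskerLeft (isCardinalPresentable (ModuleCat.{u} R) κ).ι
        (asIso (realizationAdjunction R κ).counit) ≪≫
      Functor.rightUnitor _) _

end WellGen

end
theorem mainTheorem4 (R : Type u) [CommRing R] (hR : ¬ IsNoetherianRing R)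
    [HasDerivedCategory.{w'} (ModuleCat.{u} R)] :
    ∃ κ₀ : Cardinal.{u}, ∀ (κ : Cardinal.{u}) [Fact κ.IsRegular], κ₀ ≤ κ →
      ∀ [HasDerivedCategory.{w} (WellGen.Modules (WellGen.Presentable R κ))],
        (WellGen.quotientFunctor R κ).IsLocalization (WellGen.quotientFunctor R κ).kernel.trW ∧
        Nonempty (WellGen.derivedYoneda R κ ⋙ WellGen.quotientFunctor R κ ≅
          (isCardinalPresentable (ModuleCat.{u} R) κ).ι ⋙
            DerivedCategory.singleFunctor (ModuleCat.{u} R) 0) ∧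
        ¬ WellGen.SatisfiesG2.{w', u, u + 1}
          ((WellGen.representables R κ).strictMap (WellGen.quotientFunctor R κ)) := by
  -- The bound makes every ideal smaller than `κ`, hence every `R ⧸ I` `κ`-presentable. Only the
  -- failure of (G2) uses it.
  refine ⟨Order.succ (Cardinal.mk R), fun κ _ hκ _ ↦
    ⟨(WellGen.realizationAdjunction R κ).isLocalization_mapDerivedCategory,
      ⟨WellGen.derivedYonedaCompQuotientFunctorIso R κ⟩, WellGen.not_satisfiesG2 hR _ ?_ ?_⟩⟩
  · rintro _ ⟨_, ⟨A⟩⟩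
    exact ⟨A.obj, ⟨(WellGen.derivedYonedaCompQuotientFunctorIso R κ).app A⟩⟩
  · intro I
    let A : WellGen.Presentable R κ := ⟨ModuleCat.of R (R ⧸ I),
      I.isCardinalPresentable_quotient κ
        (lt_of_le_of_lt (Cardinal.mk_set_le _) (Order.succ_le_iff.1 hκ))⟩
    exact ⟨_, ⟨_, ⟨A⟩⟩, ⟨(WellGen.derivedYonedaCompQuotientFunctorIso R κ).app A⟩⟩
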